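/- Let $\mathbb S=\mathbb R/2\pi\mathbb Z$ and let $H^1(du)$ be the real Hilbert space of maps $X\in L^2(\mathbb S;\mathbb R^2)$ with distributional derivative $X_u\in L^2(\mathbb S;\mathbb R^2)$, with inner product $\langle X,Y\rangle_{H^1(du)}=\int_0^{2\pi}X\cdot Y+X_u\cdot Y_u\,du$. With $R(x,y)=(-y,x)$ put $$A[X]=-\frac12\int_0^{2\pi}X\cdot RX_u\,du,\qquad Q[X]=\frac12\int_0^{2\pi}|X_u|^2\,du,\qquad E[X]=\frac{Q[X]}{A[X]}\quad(A[X]\neq0),$$ and let $DE[X]\in H^1(du)$ denote the $H^1(du)$-gradient of $E$ at $X$, that is, the element representing the Fréchet derivative: $dE[X](V)=\langle DE[X],V\rangle_{H^1(du)}$ for all $V\in H^1(du)$. Let $Y\in H^1(du)$ with $A[Y]\ne0$ be a critical point of $E$, i.e. $DE[Y]=0$. Then there are an open neighbourhood $\mathcal U\subset H^1(du)$ of $Y$, on which $A\neq0$ and $E$ is Fréchet differentiable, and a constant $C\in(0,\infty)$ such that $$\|DE[X]\|_{H^1(du)}\ \ge\ C\,\bigl|E[X]-E[Y]\bigr|^{1/2}\qquad\text{for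 all }X\in\mathcal U .$$ -/

import Mathlib

open MeasureTheory
open scoped ContDiff

noncomputable section

namespace SobolevCurve

/-- The Euclidean plane. -/
abbrev Plane : Type := EuclideanSpace ℝ (Fin 2)

instance instTwoPiPos : Fact (0 < 2 * Real.pi) := ⟨Real.two_pi_pos⟩

/-- The circle `ℝ / 2πℤ`; its `volume` is the length measure `du`, of total mass `2π`. -/
abbrev Circ : Type := AddCircle (2 * Real.pi)

/-- `L²(du)`: square integrable maps from the circle to the plane (up to a.e. equality). -/
abbrev L2 : Type := Lp Plane 2 (volume : Measure Circ)

/-- `X'` is the distributional derivative of `X`: for every smooth `2π`-periodic test map `φ`,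
`∫ X · φ' du = - ∫ X' · φ du`. -/
def IsWeakDeriv (X X' : L2) : Prop :=
  ∀ φ : ℝ → Plane, ContDiff ℝ ∞ φ → Function.Periodic φ (2 * Real.pi) →
    ∫ u in (0 : ℝ)..(2 * Real.pi), inner ℝ (X (u : Circ)) (deriv φ u) =
      -∫ u in (0 : ℝ)..(2 * Real.pi), inner ℝ (X' (u : Circ)) (φ u)

/-- Pairing with a continuous periodic map is an inner product in `L²(du)`. -/
theorem exists_inner_eq (ψ : ℝ → Plane) (hc : Continuous ψ)
    (hp : Function.Periodic ψ (2 * Real.pi)) :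
    ∃ Ψ : L2, ∀ f : L2,
      ∫ u in (0 : ℝ)..(2 * Real.pi), inner ℝ (f (u : Circ)) (ψ u) = inner ℝ f Ψ := by
  let g : C(Circ, Plane) := ⟨hp.lift, continuous_coinduced_dom.mpr hc⟩
  have hg : MemLp g 2 (volume : Measure Circ) := by
    obtain ⟨M, hM⟩ := isCompact_univ.exists_bound_of_continuousOn (f := g) g.continuous.continuousOn
    exact MemLp.of_bound g.continuous.aestronglyMeasurable M
      (Filter.Eventually.of_forall fun x => hM x trivial)
  refine ⟨hg.toLp g, fun f => ?_⟩
  rw [L2.inner_def]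
  have h1 : ∫ a : Circ, inner ℝ (f a) ((hg.toLp g : L2) a) = ∫ a : Circ, inner ℝ (f a) (g a) := by
    apply integral_congr_ae
    filter_upwards [hg.coeFn_toLp] with a ha
    rw [ha]
  rw [h1, ← AddCircle.intervalIntegral_preimage (2 * Real.pi) 0, zero_add]
  rfl

theorem periodic_deriv {φ : ℝ → Plane} {c : ℝ} (hp : Function.Periodic φ c) :
    Function.Periodic (deriv φ) c := by
  intro x
  rw [← deriv_comp_add_const]
  congr 1
  funext y
  exact hp y

theorem isWeakDeriv_test {φ : ℝ → Plane} (hs : ContDiff ℝ ∞ φ)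
    (hp : Function.Periodic φ (2 * Real.pi)) :
    ∃ Φ Ψ : L2, ∀ X X' : L2,
      (∫ u in (0 : ℝ)..(2 * Real.pi), inner ℝ (X (u : Circ)) (deriv φ u) =
        -∫ u in (0 : ℝ)..(2 * Real.pi), inner ℝ (X' (u : Circ)) (φ u)) ↔
      inner ℝ X Ψ = -inner ℝ X' Φ := by
  obtain ⟨Φ, hΦ⟩ := exists_inner_eq φ hs.continuous hp
  obtain ⟨Ψ, hΨ⟩ := exists_inner_eq (deriv φ) (hs.continuous_deriv (by simp)) (periodic_deriv hp)
  exact ⟨Φ, Ψ, fun X X' => by rw [hΦ, hΨ]⟩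

set_option maxHeartbeats 1000000 in
open AddCircle in
/-- An `L²(du)` map that is orthogonal to all smooth periodic maps vanishes. -/
theorem eq_zero_of_test (g : L2)
    (h : ∀ φ : ℝ → Plane, ContDiff ℝ ∞ φ → Function.Periodic φ (2 * Real.pi) →
      ∫ u in (0 : ℝ)..(2 * Real.pi), inner ℝ (g (u : Circ)) (φ u) = 0) : g = 0 := by
  have key : ∀ i : Fin 2, ∀ᵐ u : Circ, g u i = 0 := by
    intro i
    have hm : MemLp (fun u : Circ => ((g u i : ℝ) : ℂ)) 2 (volume : Measure Circ) :=
      ((Lp.memLp g).eval_piLp i).ofReal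
    have hm' := memLp_haarAddCircle_iff.2 hm
    have hint : IntervalIntegrable (fun u : ℝ => ((g (u : Circ) i : ℝ) : ℂ)) volume 0
        (2 * Real.pi) := by
      have h1 : Integrable (fun u : Circ => ((g u i : ℝ) : ℂ)) := hm.integrable (by norm_num)
      have h2 := (AddCircle.measurePreserving_mk (2 * Real.pi) 0).integrable_comp_of_integrable h1
      rw [intervalIntegrable_iff_integrableOn_Ioc_of_le Real.two_pi_pos.le]
      simpa [IntegrableOn, Function.comp_def] using h2
    have hcoef : ∀ n : ℤ, fourierCoeff (fun u : Circ => ((g u i : ℝ) : ℂ)) n = 0 := by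
      intro n
      have hper : ∀ f : ℝ → ℝ, Function.Periodic f (2 * Real.pi) →
          Function.Periodic (fun u => f (n * u)) (2 * Real.pi) := by
        intro f hf u
        have := (hf.int_mul n) (n * u)
        simp only at this ⊢
        rw [← this]; ring_nf
      have test : ∀ f : ℝ → ℝ, ContDiff ℝ ∞ f → Function.Periodic f (2 * Real.pi) →
          ∫ u in (0 : ℝ)..(2 * Real.pi), ((f (n * u) : ℝ) : ℂ) * ((g (u : Circ) i : ℝ) : ℂ)
            = 0 := by
        intro f hf hp
        have := h (fun u => f (n * u) • EuclideanSpace.single i (1 : ℝ)) (by fun_prop)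
          (fun u => by
            have := hper f hp u
            simp only at this ⊢
            rw [this])
        simp only [inner_smul_right, EuclideanSpace.inner_single_right, one_mul] at this
        simp only [conj_trivial] at this
        have h2 := congrArg (fun r : ℝ => (r : ℂ)) this
        simp only [← intervalIntegral.integral_ofReal] at h2
        simpa using h2
      have hI : ∀ f : ℝ → ℝ, Continuous f → IntervalIntegrable
          (fun u : ℝ => ((f (n * u) : ℝ) : ℂ) * ((g (u : Circ) i : ℝ) : ℂ)) volume 0
          (2 * Real.pi) := fun f hf =>
        hint.continuousOn_mul (Continuous.continuousOn (by fun_prop))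
      have hc := test Real.cos Real.contDiff_cos Real.cos_periodic
      have hs := test Real.sin Real.contDiff_sin Real.sin_periodic
      rw [fourierCoeff_eq_intervalIntegral _ _ 0, zero_add]
      have : ∀ u : ℝ, fourier (-n) (u : Circ) • ((g (u : Circ) i : ℝ) : ℂ) =
          ((Real.cos (n * u) : ℝ) : ℂ) * ((g (u : Circ) i : ℝ) : ℂ) -
          Complex.I * (((Real.sin (n * u) : ℝ) : ℂ) * ((g (u : Circ) i : ℝ) : ℂ)) := by
        intro u
        rw [fourier_coe_apply, smul_eq_mul, ← mul_assoc, ← sub_mul]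
        congr 1
        have e : (2 * Real.pi * Complex.I * ((-n : ℤ) : ℂ) * u / ((2 * Real.pi : ℝ) : ℂ)) =
            ((-(n * u) : ℝ) : ℂ) * Complex.I := by
          have : (Real.pi : ℂ) ≠ 0 := by exact_mod_cast Real.pi_ne_zero
          push_cast
          field_simp
        rw [e, Complex.exp_mul_I, ← Complex.ofReal_cos, ← Complex.ofReal_sin, Real.cos_neg,
          Real.sin_neg]
        push_cast
        ring
      simp only [this]
      rw [intervalIntegral.integral_sub, intervalIntegral.integral_const_mul, hc, hs]
      · simp
      · exact hI _ Real.continuous_cos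
      · exact (hI _ Real.continuous_sin).const_mul _
    have hz : hm'.toLp _ = 0 := by
      apply fourierBasis.repr.injective
      ext n
      rw [fourierBasis_repr, map_zero, fourierCoeff_congr_ae hm'.coeFn_toLp, hcoef]
      rfl
    have hz' := hm'.coeFn_toLp.symm.trans ((Lp.eq_zero_iff_ae_eq_zero).1 hz)
    have this : ∀ᵐ u : Circ, ((g u i : ℝ) : ℂ) = 0 :=
      Measure.ae_smul_measure hz' (ENNReal.ofReal (2 * Real.pi))
    filter_upwards [this] with u hu
    exact Complex.ofReal_eq_zero.1 hu
  rw [Lp.eq_zero_iff_ae_eq_zero]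
  filter_upwards [key 0, key 1] with u h0 h1
  ext i
  fin_cases i
  · exact h0
  · exact h1

/-- The distributional derivative is unique. -/
theorem IsWeakDeriv.unique {X X₁ X₂ : L2} (h₁ : IsWeakDeriv X X₁) (h₂ : IsWeakDeriv X X₂) :
    X₁ = X₂ := by
  rw [← sub_eq_zero]
  refine eq_zero_of_test _ fun φ hs hp => ?_
  obtain ⟨Φ, hΦ⟩ := exists_inner_eq φ hs.continuous hp
  have := (h₁ φ hs hp).symm.trans (h₂ φ hs hp)
  rw [hΦ, hΦ] at this
  rw [hΦ, inner_sub_left]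
  linarith

/-- `H¹(du)`: the maps `X` in `L²(du)` having a distributional derivative `X'` in `L²(du)`. An
element is recorded as the pair `(X, X')`, in which `X'` is determined by `X`
(see `IsWeakDeriv.unique`); the inner product inherited from the Hilbert sum is
`⟨X, Y⟩ + ⟨X', Y'⟩`, both in `L²(du)`. -/
def h1Submodule : Submodule ℝ (WithLp 2 (L2 × L2)) where
  carrier := {p | IsWeakDeriv p.fst p.snd}
  zero_mem' := by
    intro φ hs hp
    obtain ⟨Φ, Ψ, h⟩ := isWeakDeriv_test hs hp
    exact (h _ _).2 (by simp)
  add_mem' := by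
    intro p q hP hQ φ hs hp
    obtain ⟨Φ, Ψ, h⟩ := isWeakDeriv_test hs hp
    have h1 := (h _ _).1 (hP φ hs hp)
    have h2 := (h _ _).1 (hQ φ hs hp)
    refine (h _ _).2 ?_
    simp only [WithLp.add_fst, WithLp.add_snd, inner_add_left, h1, h2]
    ring
  smul_mem' := by
    intro c p hP φ hs hp
    obtain ⟨Φ, Ψ, h⟩ := isWeakDeriv_test hs hp
    have h1 := (h _ _).1 (hP φ hs hp)
    refine (h _ _).2 ?_
    simp only [WithLp.smul_fst, WithLp.smul_snd, real_inner_smul_left, h1]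
    ring

theorem isClosed_h1Submodule : IsClosed (h1Submodule : Set (WithLp 2 (L2 × L2))) := by
  have : (h1Submodule : Set (WithLp 2 (L2 × L2))) =
      ⋂ (φ : ℝ → Plane) (_ : ContDiff ℝ ∞ φ) (_ : Function.Periodic φ (2 * Real.pi)),
        {p : WithLp 2 (L2 × L2) |
          ∫ u in (0 : ℝ)..(2 * Real.pi), inner ℝ (p.fst (u : Circ)) (deriv φ u) =
            -∫ u in (0 : ℝ)..(2 * Real.pi), inner ℝ (p.snd (u : Circ)) (φ u)} := by
    ext p
    simp only [Set.mem_iInter, Set.mem_ofPred_eq]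
    rfl
  rw [this]
  refine isClosed_iInter fun φ => isClosed_iInter fun hs => isClosed_iInter fun hp => ?_
  obtain ⟨Φ, Ψ, h⟩ := isWeakDeriv_test hs hp
  simp only [h]
  refine isClosed_eq ?_ ?_
  · exact ((WithLp.continuous_fst 2 L2 L2).inner continuous_const)
  · exact ((WithLp.continuous_snd 2 L2 L2).inner continuous_const).neg

/-- The Hilbert space `H¹(du)`. -/
abbrev H1 : Type := ↥h1Submodule

instance instCompleteSpaceH1 : CompleteSpace H1 := isClosed_h1Submodule.completeSpace_coe

/-- The map underlying an element of `H¹(du)`. -/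
def H1.map (X : H1) : L2 := (X : WithLp 2 (L2 × L2)).fst

/-- The distributional derivative `X_u` of an element of `H¹(du)`. -/
def H1.du (X : H1) : L2 := (X : WithLp 2 (L2 × L2)).snd

theorem H1.isWeakDeriv (X : H1) : IsWeakDeriv X.map X.du := X.2

theorem H1.inner_eq (X Y : H1) :
    inner ℝ X Y = (∫ u : Circ, inner ℝ (X.map u) (Y.map u)) +
      ∫ u : Circ, inner ℝ (X.du u) (Y.du u) := rfl

/-- Counter-clockwise rotation of the plane by `π / 2`: `(x, y) ↦ (-y, x)`. -/
def rot (v : Plane) : Plane := !₂[-(v 1), v 0]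

/-- The signed area `A[X] = -(1/2) ∫ X · R X_u du`. -/
def area (X : H1) : ℝ := -(1 / 2) * ∫ u : Circ, inner ℝ (X.map u) (rot (X.du u))

/-- The Dirichlet energy `Q[X] = (1/2) ∫ |X_u|² du`. -/
def dirichlet (X : H1) : ℝ := (1 / 2) * ∫ u : Circ, ‖X.du u‖ ^ 2

/-- The energy `E[X] = Q[X] / A[X]`; it is only meaningful where `A[X] ≠ 0`. -/
def energy (X : H1) : ℝ := dirichlet X / area X

/-- The `H¹(du)`-gradient `DE[X]`: the Riesz representative in `H¹(du)` of the Fréchet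
derivative of `E` at `X`. -/
def gradEnergy (X : H1) : H1 := gradient energy X

/-- Critical points of `E`, which is a functional on `{X | A[X] ≠ 0}`. -/
def IsCriticalPoint (Y : H1) : Prop := area Y ≠ 0 ∧ gradEnergy Y = 0

end SobolevCurve

end

/-! Identify the plane with `ℂ` and let x_n be the Fourier coefficients of X. Both functionals
become diagonal: Q = π Σ n²|x_n|² and A = π Σ n|x_n|² (`hasSum_dirichlet`, `hasSum_area`), and the
coefficients g_n of DE[X] satisfy A(1 + n²) g_n = (n² - E n) x_n (`area_mul_coef_gradEnergy`).

Put l = E[Y]. Then A(E - l) = Q - lA = π Σ (n² - l n)|x_n|². The ratio (n² - l n)/(1 + n²) tends to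
1 as |n| → ∞, so its nonzero values stay away from zero (`exists_spectral_gap`), and |n² - l n| ≤ C
(n² - l n)²/(1 + n²). Replacing l by E[X] on the right costs a multiple of (E - l)², whence |A||E -
l| ≤ C(A²‖DE‖² + (E - l)²‖X‖²) with the L² norm of X (`abs_energy_sub_le`). Near Y the last term is
at most half of the left side and is absorbed. -/

noncomputable section

namespace SobolevCurve

open Complex ComplexConjugate AddCircle

/-! ### Complex Fourier coefficients and Parseval -/

/-- The identification of the plane with `ℂ`. -/
def toComplex (v : Plane) : ℂ := ⟨v 0, v 1⟩

theorem inner_eq_re_conj_mul (v w : Plane) :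
    inner ℝ v w = (conj (toComplex v) * toComplex w).re := by
  simp [toComplex, PiLp.inner_apply, Fin.sum_univ_two]
  ring

theorem toComplex_rot (v : Plane) : toComplex (rot v) = I * toComplex v := by
  apply Complex.ext <;> simp [toComplex, rot]

/-- The rotation as a continuous linear map. -/
def rotCLM : Plane →L[ℝ] Plane :=
  LinearMap.toContinuousLinearMap
    { toFun := rot
      map_add' := fun v w => by
        ext i; fin_cases i <;> simp [rot]; ring
      map_smul' := fun c v => by
        ext i; fin_cases i <;> simp [rot] }

/-- The rotation acting on `L²(du)`. -/
def rotL2 : L2 →L[ℝ] L2 := rotCLM.compLpL 2 volume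

theorem coeFn_rotL2 (f : L2) : ∀ᵐ u : Circ, rotL2 f u = rot (f u) :=
  rotCLM.coeFn_compLpL f

/-- The `n`-th complex Fourier coefficient of a planar `L²(du)` map. -/
def coef (f : L2) (n : ℤ) : ℂ := fourierCoeff (fun u : Circ => toComplex (f u)) n

theorem memLp_toComplex (f : L2) : MemLp (fun u : Circ => toComplex (f u)) 2 haarAddCircle := by
  have h (i : Fin 2) : MemLp (fun u : Circ => ((f u i : ℝ) : ℂ)) 2 haarAddCircle :=
    memLp_haarAddCircle_iff.2 ((Lp.memLp f).eval_piLp i).ofReal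
  have he : (fun u : Circ => toComplex (f u)) =
      (fun u : Circ => ((f u 0 : ℝ) : ℂ)) + fun u : Circ => I * ((f u 1 : ℝ) : ℂ) := by
    funext u
    apply Complex.ext <;> simp [toComplex]
  rw [he]
  exact (h 0).add ((h 1).const_mul I)

theorem ae_haarAddCircle {p : Circ → Prop} (h : ∀ᵐ u : Circ, p u) : ∀ᵐ u ∂haarAddCircle, p u := by
  rw [volume_eq_smul_haarAddCircle] at h
  exact (Measure.ae_ennreal_smul_measure_iff (by simp [Real.pi_pos])).1 h

theorem integral_eq_two_pi_mul (F : Circ → ℝ) :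
    ∫ u : Circ, F u = 2 * Real.pi * ∫ u, F u ∂haarAddCircle := by
  rw [volume_eq_smul_haarAddCircle, integral_smul_measure,
    ENNReal.toReal_ofReal Real.two_pi_pos.le, smul_eq_mul]

theorem coef_rotL2 (f : L2) (n : ℤ) : coef (rotL2 f) n = I * coef f n := by
  rw [coef, coef, ← fourierCoeff.const_mul]
  refine congrFun (fourierCoeff_congr_ae (ae_haarAddCircle ?_)) n
  filter_upwards [coeFn_rotL2 f] with u hu
  rw [hu, toComplex_rot]

/-- Parseval for the normalised Haar measure, in real parts; the factor 2π is the total length of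
the circle. -/
theorem hasSum_inner (f g : L2) :
    HasSum (fun n : ℤ => 2 * Real.pi * (conj (coef f n) * coef g n).re) (inner ℝ f g) := by
  have hf := memLp_toComplex f
  have hg := memLp_toComplex g
  have h := fourierBasis.hasSum_inner_mul_inner (hf.toLp _) (hg.toLp _)
  have hc (k : L2) (n : ℤ) : inner ℂ (fourierBasis n) ((memLp_toComplex k).toLp _) = coef k n := by
    rw [← fourierBasis.repr_apply_apply, fourierBasis_repr]
    exact congrFun (fourierCoeff_congr_ae (memLp_toComplex k).coeFn_toLp) n
  have e (n : ℤ) : conj (coef f n) * coef g n =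
      inner ℂ (hf.toLp _) (fourierBasis n) * inner ℂ (fourierBasis n) (hg.toLp _) := by
    rw [← inner_conj_symm (hf.toLp _), hc, hc]
  have hi : Integrable (fun u : Circ => conj (toComplex (f u)) * toComplex (g u)) haarAddCircle :=
    hf.star.integrable_mul hg
  have e2 : inner ℝ f g = 2 * Real.pi * (inner ℂ (hf.toLp _) (hg.toLp _)).re := by
    have : ∫ u, inner ℂ ((hf.toLp _ : Lp ℂ 2 haarAddCircle) u)
        ((hg.toLp _ : Lp ℂ 2 haarAddCircle) u) ∂haarAddCircle =
        ∫ u : Circ, conj (toComplex (f u)) * toComplex (g u) ∂haarAddCircle := by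
      refine integral_congr_ae ?_
      filter_upwards [hf.coeFn_toLp, hg.coeFn_toLp] with u h1 h2
      rw [h1, h2, RCLike.inner_apply, mul_comm]
    rw [L2.inner_def, L2.inner_def, this, show ∀ z : ℂ, z.re = RCLike.re z from fun _ => rfl,
      ← integral_re hi, integral_eq_two_pi_mul]
    simp only [inner_eq_re_conj_mul]
    rfl
  rw [e2]
  simp only [e]
  exact (Complex.hasSum_re h).mul_left (2 * Real.pi)

/-! ### Circular test maps and Fourier coefficients of derivatives -/

/-- The circle traversed `n` times, with initial phase `θ`. -/
def wave (n : ℤ) (θ : ℝ) (u : ℝ) : Plane := !₂[Real.cos (n * u + θ), Real.sin (n * u + θ)]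

theorem contDiff_wave (n : ℤ) (θ : ℝ) : ContDiff ℝ ∞ (wave n θ) := by
  rw [contDiff_piLp]
  intro i
  fin_cases i <;> simp [wave] <;> fun_prop

theorem wave_periodic (n : ℤ) (θ : ℝ) : Function.Periodic (wave n θ) (2 * Real.pi) := by
  intro u
  have h : (n : ℝ) * (u + 2 * Real.pi) + θ = n * u + θ + n * (2 * Real.pi) := by ring
  simp [wave, h, Real.cos_add_int_mul_two_pi, Real.sin_add_int_mul_two_pi]

theorem rot_wave (n : ℤ) (θ u : ℝ) : rot (wave n θ u) = wave n (θ + Real.pi / 2) u := by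
  simp [rot, wave, ← add_assoc, Real.cos_add_pi_div_two, Real.sin_add_pi_div_two]

theorem hasDerivAt_wave (n : ℤ) (θ u : ℝ) :
    HasDerivAt (wave n θ) ((n : ℝ) • wave n (θ + Real.pi / 2) u) u := by
  have h : HasDerivAt (fun u : ℝ => (n : ℝ) * u + θ) n u := by
    simpa using ((hasDerivAt_id u).const_mul (n : ℝ)).add_const θ
  have h2 : HasDerivAt (fun u : ℝ => ![Real.cos (n * u + θ), Real.sin (n * u + θ)])
      ![-Real.sin (n * u + θ) * n, Real.cos (n * u + θ) * n] u := by
    rw [hasDerivAt_pi]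
    intro i
    fin_cases i
    exacts [h.cos, h.sin]
  convert! (PiLp.hasFDerivAt_toLp 2 _).comp_hasDerivAt u h2 using 1
  ext i
  fin_cases i <;>
    simp [wave, ← add_assoc, Real.cos_add_pi_div_two, Real.sin_add_pi_div_two, mul_comm]

/-- The map `wave n θ` on the circle. -/
def waveMap (n : ℤ) (θ : ℝ) : C(Circ, Plane) :=
  ⟨(wave_periodic n θ).lift, continuous_coinduced_dom.mpr (contDiff_wave n θ).continuous⟩

theorem memLp_waveMap (n : ℤ) (θ : ℝ) : MemLp (waveMap n θ) 2 (volume : Measure Circ) := by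
  obtain ⟨M, hM⟩ := isCompact_univ.exists_bound_of_continuousOn (waveMap n θ).continuous.continuousOn
  exact MemLp.of_bound (waveMap n θ).continuous.aestronglyMeasurable M
    (Filter.Eventually.of_forall fun x => hM x trivial)

/-- The map `wave n θ` as an element of `L²(du)`. -/
def waveL2 (n : ℤ) (θ : ℝ) : L2 := (memLp_waveMap n θ).toLp _

theorem coeFn_waveL2 (n : ℤ) (θ : ℝ) : waveL2 n θ =ᵐ[volume] waveMap n θ :=
  (memLp_waveMap n θ).coeFn_toLp

theorem rotL2_waveL2 (n : ℤ) (θ : ℝ) : rotL2 (waveL2 n θ) = waveL2 n (θ + Real.pi / 2) := by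
  apply Lp.ext
  filter_upwards [coeFn_rotL2 (waveL2 n θ), coeFn_waveL2 n θ, coeFn_waveL2 n (θ + Real.pi / 2)]
    with u h1 h2 h3
  rw [h1, h2, h3]
  induction u using QuotientAddGroup.induction_on with
  | H u => exact rot_wave n θ u

theorem integral_inner_wave (f : L2) (n : ℤ) (θ : ℝ) :
    ∫ u in (0 : ℝ)..(2 * Real.pi), inner ℝ (f (u : Circ)) (wave n θ u) =
      inner ℝ f (waveL2 n θ) := by
  rw [L2.inner_def]
  have h : ∫ a : Circ, inner ℝ (f a) (waveL2 n θ a) = ∫ a : Circ, inner ℝ (f a) (waveMap n θ a) := by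
    apply integral_congr_ae
    filter_upwards [coeFn_waveL2 n θ] with a ha
    rw [ha]
  rw [h, ← AddCircle.intervalIntegral_preimage (2 * Real.pi) 0, zero_add]
  rfl

theorem integral_waveL2_inner (n : ℤ) (θ : ℝ) (ψ : ℝ → Plane)
    (hp : Function.Periodic ψ (2 * Real.pi)) :
    ∫ u in (0 : ℝ)..(2 * Real.pi), inner ℝ (waveL2 n θ (u : Circ)) (ψ u) =
      ∫ u in (0 : ℝ)..(2 * Real.pi), inner ℝ (wave n θ u) (ψ u) := by
  have h1 := AddCircle.intervalIntegral_preimage (2 * Real.pi) 0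
    (fun u : Circ => (inner ℝ (waveL2 n θ u) (hp.lift u) : ℝ))
  have h2 := AddCircle.intervalIntegral_preimage (2 * Real.pi) 0
    (fun u : Circ => (inner ℝ (waveMap n θ u) (hp.lift u) : ℝ))
  rw [zero_add] at h1 h2
  refine h1.trans (Eq.trans ?_ h2.symm)
  apply integral_congr_ae
  filter_upwards [coeFn_waveL2 n θ] with a ha
  rw [ha]

/-- In complex notation the wave is e^{iθ}e^{inu}, so phases 0 and π/2 read off the real and
imaginary parts of the coefficient. -/
theorem inner_waveL2 (f : L2) (n : ℤ) (θ : ℝ) :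
    inner ℝ f (waveL2 n θ) = 2 * Real.pi * (coef f n * conj (exp (θ * I))).re := by
  have hi : Integrable (fun u : Circ => conj (toComplex (waveL2 n θ u)) * toComplex (f u))
      haarAddCircle := (memLp_toComplex (waveL2 n θ)).star.integrable_mul (memLp_toComplex f)
  have h : coef f n * conj (exp (θ * I)) =
      ∫ u : Circ, conj (toComplex (waveL2 n θ u)) * toComplex (f u) ∂haarAddCircle := by
    rw [coef, fourierCoeff, ← integral_mul_const]
    have hw := ae_haarAddCircle (coeFn_waveL2 n θ)
    apply integral_congr_ae
    filter_upwards [hw] with u hu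
    rw [hu, smul_eq_mul, mul_right_comm]
    congr 1
    induction u using QuotientAddGroup.induction_on with
    | H u =>
      rw [fourier_neg, ← map_mul]
      congr 1
      change fourier n (u : Circ) * _ = toComplex (wave n θ u)
      rw [fourier_coe_apply, ← Complex.exp_add]
      have e : (2 * Real.pi * Complex.I * n * u / ((2 * Real.pi : ℝ) : ℂ)) + θ * I =
          ((n * u + θ : ℝ) : ℂ) * Complex.I := by
        have : (Real.pi : ℂ) ≠ 0 := by exact_mod_cast Real.pi_ne_zero
        push_cast
        field_simp
      rw [e, Complex.exp_mul_I]
      apply Complex.ext <;> simp [toComplex, wave, -ofReal_mul, -ofReal_add, ← ofReal_cos, ← ofReal_sin]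
  rw [h, real_inner_comm, L2.inner_def, show ∀ z : ℂ, z.re = RCLike.re z from fun _ => rfl,
    ← integral_re hi, integral_eq_two_pi_mul]
  simp only [inner_eq_re_conj_mul]
  rfl

theorem inner_waveL2_zero (f : L2) (n : ℤ) :
    inner ℝ f (waveL2 n 0) = 2 * Real.pi * (coef f n).re := by
  simp [inner_waveL2]

theorem inner_waveL2_pi_div_two (f : L2) (n : ℤ) :
    inner ℝ f (waveL2 n (Real.pi / 2)) = 2 * Real.pi * (coef f n).im := by
  have : exp ((Real.pi / 2 : ℝ) * I) = I := by
    push_cast; exact Complex.exp_pi_div_two_mul_I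
  rw [inner_waveL2, this]
  simp

theorem waveL2_add_pi (n : ℤ) (θ : ℝ) : waveL2 n (θ + Real.pi / 2 + Real.pi / 2) = -waveL2 n θ := by
  rw [← rotL2_waveL2, ← rotL2_waveL2]
  apply Lp.ext
  filter_upwards [coeFn_rotL2 (rotL2 (waveL2 n θ)), coeFn_rotL2 (waveL2 n θ),
    Lp.coeFn_neg (waveL2 n θ)] with u h1 h2 h3
  rw [h1, h2, h3]
  ext i
  fin_cases i <;> simp [rot]

theorem isWeakDeriv_waveL2 (n : ℤ) (θ : ℝ) :
    IsWeakDeriv (waveL2 n θ) ((n : ℝ) • waveL2 n (θ + Real.pi / 2)) := by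
  intro φ hs hp
  have hsm : ∫ u in (0 : ℝ)..(2 * Real.pi),
      inner ℝ (((n : ℝ) • waveL2 n (θ + Real.pi / 2) : L2) (u : Circ)) (φ u) =
      n * ∫ u in (0 : ℝ)..(2 * Real.pi), inner ℝ (waveL2 n (θ + Real.pi / 2) (u : Circ)) (φ u) := by
    obtain ⟨Φ, hΦ⟩ := exists_inner_eq φ hs.continuous hp
    rw [hΦ, hΦ, real_inner_smul_left]
  rw [hsm, integral_waveL2_inner _ _ _ (periodic_deriv hp), integral_waveL2_inner _ _ _ hp,
    ← intervalIntegral.integral_const_mul, eq_neg_iff_add_eq_zero]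
  have hw := (contDiff_wave n θ).continuous
  have hw' := (contDiff_wave n (θ + Real.pi / 2)).continuous
  have hφ := hs.continuous
  have hφ' := hs.continuous_deriv (by simp)
  have i1 : IntervalIntegrable (fun u => (inner ℝ (wave n θ u) (deriv φ u) : ℝ)) volume 0
      (2 * Real.pi) := (hw.inner hφ').intervalIntegrable _ _
  have i2 : IntervalIntegrable (fun u => (n : ℝ) * inner ℝ (wave n (θ + Real.pi / 2) u) (φ u))
      volume 0 (2 * Real.pi) := ((hw'.inner hφ).const_mul _).intervalIntegrable _ _
  rw [← intervalIntegral.integral_add i1 i2,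
    intervalIntegral.integral_eq_sub_of_hasDerivAt (f := fun u => inner ℝ (wave n θ u) (φ u)) _
      (i1.add i2)]
  · have h1 := wave_periodic n θ 0
    have h2 := hp 0
    rw [zero_add] at h1 h2
    rw [h1, h2, sub_self]
  · intro u _
    have := (hasDerivAt_wave n θ u).inner ℝ
      ((hs.differentiable (by simp)).differentiableAt.hasDerivAt (x := u))
    simpa only [real_inner_smul_left] using this

/-- The map `wave n θ` as an element of `H¹(du)`. -/
def waveH1 (n : ℤ) (θ : ℝ) : H1 :=
  ⟨WithLp.toLp 2 (waveL2 n θ, (n : ℝ) • waveL2 n (θ + Real.pi / 2)), isWeakDeriv_waveL2 n θ⟩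

/-- Testing the weak derivative against waves of phases 0 and π/2 gives the two real components. -/
theorem coef_du (X : H1) (n : ℤ) : coef X.du n = I * n * coef X.map n := by
  have h (θ : ℝ) : n * inner ℝ X.map (waveL2 n (θ + Real.pi / 2)) =
      -inner ℝ X.du (waveL2 n θ) := by
    have := X.isWeakDeriv (wave n θ) (contDiff_wave n θ) (wave_periodic n θ)
    rw [integral_inner_wave] at this
    rw [← this, ← integral_inner_wave, ← intervalIntegral.integral_const_mul]
    congr 1
    funext u
    rw [(hasDerivAt_wave n θ u).deriv, real_inner_smul_right]
  have h1 := h 0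
  have h2 := h (0 + Real.pi / 2)
  rw [waveL2_add_pi, inner_neg_right] at h2
  simp only [zero_add, inner_waveL2_zero, inner_waveL2_pi_div_two] at h1 h2
  have hpi := Real.two_pi_pos
  have hre : (coef X.du n).re = -(n * (coef X.map n).im) :=
    mul_left_cancel₀ hpi.ne' (by linear_combination h1)
  have him : (coef X.du n).im = n * (coef X.map n).re :=
    mul_left_cancel₀ hpi.ne' (by linear_combination h2)
  apply Complex.ext <;> simp [hre, him]

/-! ### Derivatives of area, Dirichlet energy and their quotient -/

/-- The inclusion of `H¹(du)` into `L²(du)`. -/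
def mapL : H1 →L[ℝ] L2 :=
  ContinuousLinearMap.fst ℝ L2 L2 ∘L
    (WithLp.prodContinuousLinearEquiv 2 ℝ L2 L2 : WithLp 2 (L2 × L2) →L[ℝ] L2 × L2) ∘L
      h1Submodule.subtypeL

/-- The distributional derivative as a continuous linear map. -/
def duL : H1 →L[ℝ] L2 :=
  ContinuousLinearMap.snd ℝ L2 L2 ∘L
    (WithLp.prodContinuousLinearEquiv 2 ℝ L2 L2 : WithLp 2 (L2 × L2) →L[ℝ] L2 × L2) ∘L
      h1Submodule.subtypeL

@[simp] theorem mapL_apply (X : H1) : mapL X = X.map := rfl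

@[simp] theorem duL_apply (X : H1) : duL X = X.du := rfl

theorem inner_H1 (X Y : H1) : (inner ℝ X Y : ℝ) = inner ℝ X.map Y.map + inner ℝ X.du Y.du := rfl

theorem area_eq_inner (X : H1) : area X = -(1 / 2) * inner ℝ (mapL X) ((rotL2 ∘L duL) X) := by
  rw [area, L2.inner_def]
  congr 1
  apply integral_congr_ae
  filter_upwards [coeFn_rotL2 X.du] with u hu
  simp [hu]

theorem dirichlet_eq_inner (X : H1) : dirichlet X = 1 / 2 * inner ℝ (duL X) (duL X) := by
  rw [dirichlet, L2.inner_def]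
  simp

theorem hasFDerivAt_area (X : H1) : ∃ A' : H1 →L[ℝ] ℝ, HasFDerivAt area A' X ∧
    ∀ Z, A' Z = -(1 / 2) * (inner ℝ X.map (rotL2 Z.du) + inner ℝ Z.map (rotL2 X.du)) := by
  have h := ((mapL.hasFDerivAt (x := X)).inner ℝ ((rotL2 ∘L duL).hasFDerivAt (x := X))).const_mul
    (-(1 / 2) : ℝ)
  simp only [← area_eq_inner] at h
  exact ⟨_, h, fun Z => by simp⟩

theorem hasFDerivAt_dirichlet (X : H1) : ∃ Q' : H1 →L[ℝ] ℝ, HasFDerivAt dirichlet Q' X ∧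
    ∀ Z, Q' Z = inner ℝ X.du Z.du := by
  have h := ((duL.hasFDerivAt (x := X)).inner ℝ (duL.hasFDerivAt (x := X))).const_mul
    (1 / 2 : ℝ)
  simp only [← dirichlet_eq_inner] at h
  refine ⟨_, h, fun Z => ?_⟩
  simp [real_inner_comm X.du Z.du]
  ring

theorem continuous_area : Continuous area :=
  continuous_iff_continuousAt.2 fun X => (hasFDerivAt_area X).choose_spec.1.continuousAt

theorem differentiableAt_energy {X : H1} (hX : area X ≠ 0) : DifferentiableAt ℝ energy X := by
  obtain ⟨A', hA, -⟩ := hasFDerivAt_area X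
  obtain ⟨Q', hQ, -⟩ := hasFDerivAt_dirichlet X
  have h := hQ.differentiableAt.fun_mul (hA.differentiableAt.fun_inv hX)
  simp only [← div_eq_mul_inv] at h
  exact h

/-- The product rule applied to E·A = Q gives A dE = dQ - E dA, with no quotient to expand. -/
theorem area_mul_inner_gradEnergy {X : H1} (hX : area X ≠ 0) (Z : H1) :
    area X * inner ℝ (gradEnergy X) Z = inner ℝ X.du Z.du +
      energy X / 2 * (inner ℝ X.map (rotL2 Z.du) + inner ℝ Z.map (rotL2 X.du)) := by
  obtain ⟨A', hA, hA'⟩ := hasFDerivAt_area X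
  obtain ⟨Q', hQ, hQ'⟩ := hasFDerivAt_dirichlet X
  have hE := (differentiableAt_energy hX).hasFDerivAt
  have hprod : HasFDerivAt (fun W => energy W * area W) Q' X := by
    refine hQ.congr_of_eventuallyEq ?_
    filter_upwards [continuous_area.continuousAt.eventually_ne hX] with W hW
    exact div_mul_cancel₀ _ hW
  have h := congrArg (fun T : H1 →L[ℝ] ℝ => T Z) ((hE.mul hA).unique hprod)
  have hG : inner ℝ (gradEnergy X) Z = fderiv ℝ energy X Z := by
    rw [← toDual_gradient]; rfl
  simp [hA', hQ'] at h
  rw [hG, ← h]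
  ring

/-! ### Diagonalisation in Fourier modes -/

theorem waveH1_map (n : ℤ) (θ : ℝ) : (waveH1 n θ).map = waveL2 n θ := rfl

theorem waveH1_du (n : ℤ) (θ : ℝ) :
    (waveH1 n θ).du = (n : ℝ) • waveL2 n (θ + Real.pi / 2) := rfl

theorem area_mul_inner_gradEnergy_waveH1 {X : H1} (hX : area X ≠ 0) (n : ℤ) (θ : ℝ) :
    area X * (inner ℝ (gradEnergy X).map (waveL2 n θ) +
        n * inner ℝ (gradEnergy X).du (waveL2 n (θ + Real.pi / 2))) =
      n * inner ℝ X.du (waveL2 n (θ + Real.pi / 2)) +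
        energy X / 2 * (inner ℝ (rotL2 X.du) (waveL2 n θ) - n * inner ℝ X.map (waveL2 n θ)) := by
  have h := area_mul_inner_gradEnergy hX (waveH1 n θ)
  rw [inner_H1, waveH1_map, waveH1_du, map_smul, rotL2_waveL2, waveL2_add_pi] at h
  simp only [real_inner_smul_right, inner_neg_right] at h
  rw [real_inner_comm (rotL2 X.du) (waveL2 n θ)] at h
  linarith

theorem area_mul_coef_gradEnergy {X : H1} (hX : area X ≠ 0) (n : ℤ) :
    (area X * (1 + n ^ 2) : ℝ) * coef (gradEnergy X).map n =
      (n ^ 2 - energy X * n : ℝ) * coef X.map n := by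
  have h1 := area_mul_inner_gradEnergy_waveH1 hX n 0
  have h2 := area_mul_inner_gradEnergy_waveH1 hX n (0 + Real.pi / 2)
  rw [waveL2_add_pi] at h2
  simp only [zero_add, inner_neg_right, inner_waveL2_zero, inner_waveL2_pi_div_two, coef_rotL2,
    coef_du] at h1 h2
  simp at h1 h2
  have hpi := Real.two_pi_pos
  apply Complex.ext
  · rw [re_ofReal_mul, re_ofReal_mul]
    exact mul_left_cancel₀ hpi.ne' (by linear_combination h1)
  · rw [im_ofReal_mul, im_ofReal_mul]
    exact mul_left_cancel₀ hpi.ne' (by linear_combination h2)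

theorem hasSum_norm_map_sq (X : H1) :
    HasSum (fun n : ℤ => 2 * Real.pi * ‖coef X.map n‖ ^ 2) (‖X.map‖ ^ 2) := by
  rw [← real_inner_self_eq_norm_sq]
  convert! hasSum_inner X.map X.map using 3 with n
  rw [conj_mul', ← ofReal_pow, ofReal_re]

theorem hasSum_inner_du (X : H1) :
    HasSum (fun n : ℤ => 2 * Real.pi * (n ^ 2 * ‖coef X.map n‖ ^ 2)) (inner ℝ X.du X.du) := by
  convert! hasSum_inner X.du X.du using 3 with n
  rw [conj_mul', ← ofReal_pow, ofReal_re, coef_du]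
  simp [mul_pow]

theorem hasSum_dirichlet (X : H1) :
    HasSum (fun n : ℤ => Real.pi * (n ^ 2 * ‖coef X.map n‖ ^ 2)) (dirichlet X) := by
  rw [dirichlet_eq_inner]
  convert! (hasSum_inner_du X).mul_left (1 / 2) using 2 with n
  ring

/-- The rotation multiplies coefficients by i and the derivative by i n; their product -n makes the
area diagonal but indefinite. -/
theorem hasSum_area (X : H1) :
    HasSum (fun n : ℤ => Real.pi * (n * ‖coef X.map n‖ ^ 2)) (area X) := by
  rw [area_eq_inner]
  convert! (hasSum_inner X.map (rotL2 X.du)).mul_left (-(1 / 2)) using 2 with n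
  have : conj (coef X.map n) * coef (rotL2 X.du) n = ((-(n * ‖coef X.map n‖ ^ 2) : ℝ) : ℂ) := by
    rw [coef_rotL2, coef_du]
    push_cast
    rw [← conj_mul']
    linear_combination (n * conj (coef X.map n) * coef X.map n) * I_mul_I
  rw [this, ofReal_re]
  ring

theorem hasSum_norm_sq (X : H1) :
    HasSum (fun n : ℤ => 2 * Real.pi * ((1 + n ^ 2) * ‖coef X.map n‖ ^ 2)) (‖X‖ ^ 2) := by
  rw [← real_inner_self_eq_norm_sq, inner_H1, real_inner_self_eq_norm_sq X.map]
  convert! (hasSum_norm_map_sq X).add (hasSum_inner_du X) using 2 with n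
  ring

/-! ### Spectral gap and the quantitative inequality -/

/-- The nonzero values of `(n² - l n) / (1 + n²)`, `n ∈ ℤ`, are bounded away from zero. -/
theorem exists_spectral_gap (l : ℝ) : ∃ C : ℝ, 0 < C ∧
    ∀ n : ℤ, |(n : ℝ) ^ 2 - l * n| * (1 + n ^ 2) ≤ C * ((n : ℝ) ^ 2 - l * n) ^ 2 := by
  -- Beyond N the ratio (1 + n²)/|n² - l n| is at most 4; the finitely many other modes are bounded
  -- by the sum of their ratios. Where n² = l n, division by zero makes `r n` equal to 0.
  obtain ⟨N, hN⟩ := exists_nat_gt (2 * |l| + 2)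
  let r : ℤ → ℝ := fun n => (1 + (n : ℝ) ^ 2) / |(n : ℝ) ^ 2 - l * n|
  have hr (n : ℤ) : 0 ≤ r n := by positivity
  have hS : 0 ≤ ∑ n ∈ Finset.Icc (-N : ℤ) N, r n := Finset.sum_nonneg fun n _ => hr n
  refine ⟨4 + ∑ n ∈ Finset.Icc (-N : ℤ) N, r n, by positivity, fun n => ?_⟩
  rcases eq_or_ne ((n : ℝ) ^ 2 - l * n) 0 with h0 | h0
  · simp [h0]
  have hpos := abs_pos.2 h0
  suffices h : 1 + (n : ℝ) ^ 2 ≤ (4 + ∑ n ∈ Finset.Icc (-N : ℤ) N, r n) * |(n : ℝ) ^ 2 - l * n| by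
    rw [← sq_abs (_ - _)]
    nlinarith
  by_cases hn : n ∈ Finset.Icc (-N : ℤ) N
  · have h1 := Finset.single_le_sum (fun n _ => hr n) hn
    have h2 : 1 + (n : ℝ) ^ 2 = r n * |(n : ℝ) ^ 2 - l * n| := (div_mul_cancel₀ _ hpos.ne').symm
    nlinarith
  · have hn' : (N : ℝ) < |(n : ℝ)| := by
      by_contra! h
      apply hn
      rw [abs_le] at h
      rw [Finset.mem_Icc]
      exact ⟨by exact_mod_cast h.1, by exact_mod_cast h.2⟩
    have h1 : (n : ℝ) ^ 2 - |l| * |(n : ℝ)| ≤ |(n : ℝ) ^ 2 - l * n| := by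
      rw [← abs_mul]
      exact (sub_le_sub_left (le_abs_self _) _).trans (le_abs_self _)
    have h2 : (n : ℝ) ^ 2 = |(n : ℝ)| ^ 2 := (sq_abs _).symm
    have h3 := abs_nonneg l
    have h4 : 1 + (n : ℝ) ^ 2 ≤ 4 * |(n : ℝ) ^ 2 - l * n| := by
      rw [h2] at h1 ⊢
      nlinarith
    nlinarith

theorem abs_energy_sub_le {l C : ℝ} (hC : 0 < C)
    (h : ∀ n : ℤ, |(n : ℝ) ^ 2 - l * n| * (1 + n ^ 2) ≤ C * ((n : ℝ) ^ 2 - l * n) ^ 2)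
    {X : H1} (hX : area X ≠ 0) :
    |area X| * |energy X - l| ≤
      C * (area X ^ 2 * ‖gradEnergy X‖ ^ 2 + (energy X - l) ^ 2 * ‖X.map‖ ^ 2) := by
  have hsum : HasSum (fun n : ℤ => Real.pi * (((n : ℝ) ^ 2 - l * n) * ‖coef X.map n‖ ^ 2))
      (area X * (energy X - l)) := by
    convert! (hasSum_dirichlet X).sub ((hasSum_area X).mul_left l) using 1
    · funext n; ring
    · rw [energy]; field_simp
  have hbound := (((hasSum_norm_sq (gradEnergy X)).mul_left (area X ^ 2)).add
    ((hasSum_norm_map_sq X).mul_left ((energy X - l) ^ 2))).mul_left C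
  have hterm (n : ℤ) : |(n : ℝ) ^ 2 - l * n| * ‖coef X.map n‖ ^ 2 ≤
      2 * C * (area X ^ 2 * ((1 + n ^ 2) * ‖coef (gradEnergy X).map n‖ ^ 2) +
        (energy X - l) ^ 2 * ‖coef X.map n‖ ^ 2) := by
    have hg : area X ^ 2 * (1 + (n : ℝ) ^ 2) ^ 2 * ‖coef (gradEnergy X).map n‖ ^ 2 =
        ((n : ℝ) ^ 2 - energy X * n) ^ 2 * ‖coef X.map n‖ ^ 2 := by
      have := congrArg (fun z : ℂ => ‖z‖ ^ 2) (area_mul_coef_gradEnergy hX n)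
      simpa only [norm_mul, norm_real, mul_pow, Real.norm_eq_abs, sq_abs] using this
    set p := ‖coef X.map n‖ ^ 2
    set g := ‖coef (gradEnergy X).map n‖ ^ 2
    have hp : 0 ≤ p := by positivity
    have hn : (0 : ℝ) < 1 + (n : ℝ) ^ 2 := by positivity
    -- The extra factor 1 + n² brings in the square of the gradient identity, `hg`.
    refine le_of_mul_le_mul_right ?_ hn
    calc |(n : ℝ) ^ 2 - l * n| * p * (1 + (n : ℝ) ^ 2)
        = |(n : ℝ) ^ 2 - l * n| * (1 + (n : ℝ) ^ 2) * p := by ring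
      _ ≤ C * ((n : ℝ) ^ 2 - l * n) ^ 2 * p := mul_le_mul_of_nonneg_right (h n) hp
      _ ≤ C * (2 * (((n : ℝ) ^ 2 - energy X * n) ^ 2 +
            (energy X - l) ^ 2 * (1 + (n : ℝ) ^ 2))) * p := by
          gcongr
          -- Split n² - l n = (n² - E n) + (E - l) n, then use (a + b)² ≤ 2a² + 2b² and n² ≤ 1 + n².
          nlinarith [sq_nonneg ((n : ℝ) ^ 2 - energy X * n - (energy X - l) * n),
            sq_nonneg (energy X - l)]
      _ = 2 * C * (((n : ℝ) ^ 2 - energy X * n) ^ 2 * p +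
            (energy X - l) ^ 2 * p * (1 + (n : ℝ) ^ 2)) := by ring
      _ = _ := by rw [← hg]; ring
  rw [← abs_mul]
  have hpi := Real.pi_pos
  refine abs_le.2 ⟨neg_le.1 (hasSum_le (fun n => ?_) hsum.neg hbound),
    hasSum_le (fun n => ?_) hsum hbound⟩
  · have h1 := mul_le_mul_of_nonneg_left (hterm n) hpi.le
    have h2 := mul_le_mul_of_nonneg_left (mul_le_mul_of_nonneg_right
      (neg_le_abs ((n : ℝ) ^ 2 - l * n)) (sq_nonneg ‖coef X.map n‖)) hpi.le
    linarith
  · have h1 := mul_le_mul_of_nonneg_left (hterm n) hpi.le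
    have h2 := mul_le_mul_of_nonneg_left (mul_le_mul_of_nonneg_right
      (le_abs_self ((n : ℝ) ^ 2 - l * n)) (sq_nonneg ‖coef X.map n‖)) hpi.le
    linarith

end SobolevCurve

end

/-! ### Absorption near the critical point -/

theorem corollary7p4 (Y : SobolevCurve.H1) (hY : SobolevCurve.IsCriticalPoint Y) :
    ∃ U : Set SobolevCurve.H1, IsOpen U ∧ Y ∈ U ∧ (∀ X ∈ U, SobolevCurve.area X ≠ 0) ∧
      ∃ C : ℝ, 0 < C ∧ ∀ X ∈ U,
        HasGradientAt SobolevCurve.energy (SobolevCurve.gradEnergy X) X ∧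
        C * |SobolevCurve.energy X - SobolevCurve.energy Y| ^ (1 / 2 : ℝ) ≤
          ‖SobolevCurve.gradEnergy X‖ := by
  open SobolevCurve in
  have hA := hY.1
  obtain ⟨C, hC, hgap⟩ := exists_spectral_gap (energy Y)
  -- At Y this function equals |A[Y]| > 0. Its positivity nearby says that C(E - l)²‖X‖² is at most
  -- half of |A||E - l|.
  have hcont : ContinuousAt
      (fun X : H1 => |area X| - 2 * C * (|energy X - energy Y| * ‖X.map‖ ^ 2)) Y := by
    have h1 := (differentiableAt_energy hA).continuousAt
    have h2 := continuous_area.continuousAt (x := Y)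
    have h3 : ContinuousAt (fun X : H1 => X.map) Y := mapL.continuous.continuousAt
    fun_prop
  have hev : ∀ᶠ X in nhds Y, area X ≠ 0 ∧ |area X| < |area Y| + 1 ∧
      0 < |area X| - 2 * C * (|energy X - energy Y| * ‖X.map‖ ^ 2) :=
    (continuous_area.continuousAt.eventually_ne hA).and <|
      ((continuous_area.abs.continuousAt (x := Y)).eventually_lt_const (by simp)).and <|
        hcont.eventually_const_lt (by simpa using hA)
  obtain ⟨U, hU, hUo, hYU⟩ := eventually_nhds_iff.1 hev
  have hK : 0 < 2 * C * (|area Y| + 1) := by positivity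
  refine ⟨U, hUo, hYU, fun X hX => (hU X hX).1, (√(2 * C * (|area Y| + 1)))⁻¹, by positivity,
    fun X hX => ⟨(differentiableAt_energy (hU X hX).1).hasGradientAt, ?_⟩⟩
  obtain ⟨hX0, hX1, hX2⟩ := hU X hX
  have hpos := abs_pos.2 hX0
  have hmain := abs_energy_sub_le hC hgap hX0
  rw [← sq_abs (area X), ← sq_abs (energy X - energy Y)] at hmain
  set a := |area X|
  set e := |energy X - energy Y|
  have he : 0 ≤ e := abs_nonneg _
  have hle : e ≤ 2 * C * (|area Y| + 1) * ‖gradEnergy X‖ ^ 2 := by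
    have h1 : e ≤ 2 * C * a * ‖gradEnergy X‖ ^ 2 := by
      refine le_of_mul_le_mul_left ?_ hpos
      -- Doubling `hmain` and absorbing the error term into one copy of `a * e` leaves a e ≤ 2C
      -- a²‖DE‖².
      nlinarith [mul_nonneg he hX2.le]
    refine h1.trans ?_
    gcongr
  rw [← Real.sqrt_eq_rpow, inv_mul_le_iff₀ (Real.sqrt_pos.2 hK)]
  refine Real.sqrt_le_iff.2 ⟨by positivity, ?_⟩
  rwa [mul_pow, Real.sq_sqrt hK.le]
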